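/- Let $$E_5=\bigl\{[0;a_1,a_2,a_3,\dots] \;:\; a_n\in\{1,2,3,4,5\}\text{ for all } n\ge 1\bigr\}\subset[0,1]$$ be the set of values of all infinite continued fractions $$[0;a_1,a_2,a_3,\dots]=\cfrac{1}{a_1+\cfrac{1}{a_2+\cfrac{1}{a_3+\cdots}}}$$ with digits in $\{1,\dots,5\}$, where the value is the limit of the convergents $[0;a_1,\dots,a_n]$ as $n\to\infty$. Then the Hausdorff dimension of $E_5$ satisfies $$\dim_H(E_5)=0.836829443681\pm 10^{-12},$$ that is, $0.836829443681-10^{-12}\le \dim_H(E_5)\le 0.836829443681+10^{-12}$. In particular $\dim_H(E_5)>\tfrac56$. -/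

import Mathlib

open Filter Topology MeasureTheory
open scoped ENNReal

/-- The infinite regular continued fraction `[0; a 0, a 1, a 2, …]`: integer part `0`, all partial
numerators `1`, partial denominators `a 0, a 1, a 2, …`. -/
noncomputable def regularContFract (a : ℕ → ℕ) : GenContFract ℝ where
  h := 0
  s := Stream'.Seq.ofStream fun n => ⟨1, (a n : ℝ)⟩

/-- `contFractSet m` is the set of the values `[0; a 0, a 1, …]`, that is, of the limits of the
convergents, of all infinite continued fractions with digits in `{1, …, m}`. -/
def contFractSet (m : ℕ) : Set ℝ :=
  {x | ∃ a : ℕ → ℕ, (∀ n, a n ∈ Set.Icc 1 m) ∧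
    Tendsto (regularContFract a).convs atTop (𝓝 x)}

/-! The set is generated by the maps x ↦ 1/(a+x), a ≤ 5, and its dimension should be the t for which
the transfer operator L f(x) = ∑ (a+x)^(-2t) f(1/(a+x)) has leading eigenvalue 1. One-sided test
functions suffice to locate t.

If f is bounded below by a positive constant and L f ≤ f, iterating L bounds ∑ diam^t over the
cylinders of level n uniformly in n, so the t-dimensional Hausdorff measure is finite
(`dimH_contFractSet_le`). If f is also bounded above and L f ≥ λ f with λ > 1, then at some level n
lower bounds r_w for the contraction of the branches satisfy ∑ r_w^t ≥ 1. Expanding points of [0,1)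
with weights proportional to r_w^t parametrizes a subset of the limit set, and the inverse of this
parametrization is t-Hölder (`le_dimH_contFractSet`). Bounded distortion, `cfDen_le_two_mul`, makes
all constants independent of n.

For both exponents f is the same polynomial in z = 2x - 1 with integer coefficients at scale 10^20,
close to the eigenfunction. L f is enclosed by an integer polynomial with an explicit integer error
(`abs_transferList_le`), so each inequality between L f and f on [0,1] becomes one integer
comparison (`transferList_lower`, `transferList_upper`). -/

/-! ### Fixed-point polynomial arithmetic on `[-1, 1]` -/

/-- The value at `z` of the polynomial with the given coefficients, constant term first. -/
def evalList : List ℤ → ℝ → ℝ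
  | [], _ => 0
  | c :: p, z => c + z * evalList p z

def addList : List ℤ → List ℤ → List ℤ
  | [], q => q
  | c :: p, [] => c :: p
  | c :: p, d :: q => (c + d) :: addList p q

def derivList : List ℤ → List ℤ
  | [] => []
  | _ :: p => addList p (0 :: derivList p)

def normList : List ℤ → ℤ
  | [] => 0
  | c :: p => c.natAbs + normList p

/-- Approximate quotient of a polynomial by `m + z`, with rounded coefficients. -/
def divList (m : ℤ) : ℤ → List ℤ → List ℤ
  | _, [] => []
  | b, c :: p => (c - b) / m :: divList m ((c - b) / m) p

/-- Bound for the remainder left by `divList`. -/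
def divListErr (m : ℤ) : ℤ → List ℤ → ℤ
  | b, [] => b.natAbs
  | b, c :: p => m + divListErr m ((c - b) / m) p

def mulRound (S f : ℤ) (p : List ℤ) : List ℤ := p.map fun c => c * f / S

theorem evalList_addList (p q : List ℤ) (z : ℝ) :
    evalList (addList p q) z = evalList p z + evalList q z := by
  fun_induction addList p q with
  | case1 q => simp [evalList]
  | case2 c p => simp [evalList]
  | case3 c p d q ih => simp only [evalList, ih]; push_cast; ring

theorem evalList_map_mul (k : ℤ) (p : List ℤ) (z : ℝ) :
    evalList (p.map (k * ·)) z = k * evalList p z := by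
  induction p with
  | nil => simp [evalList]
  | cons c p ih => simp only [List.map_cons, evalList, ih]; push_cast; ring

theorem hasDerivAt_evalList (p : List ℤ) (z : ℝ) :
    HasDerivAt (evalList p) (evalList (derivList p) z) z := by
  induction p with
  | nil => exact hasDerivAt_const z (0 : ℝ)
  | cons c p ih =>
    have h := ((hasDerivAt_id z).mul ih).const_add (c : ℝ)
    refine h.congr_deriv ?_
    simp [derivList, evalList_addList, evalList]

theorem abs_evalList_le (p : List ℤ) {z : ℝ} (hz : |z| ≤ 1) : |evalList p z| ≤ normList p := by
  induction p with
  | nil => simp [evalList, normList]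
  | cons c p ih =>
    have h : |z * evalList p z| ≤ 1 * normList p := by
      rw [abs_mul]; exact mul_le_mul hz ih (abs_nonneg _) zero_le_one
    calc |evalList (c :: p) z| ≤ |(c : ℝ)| + |z * evalList p z| := abs_add_le _ _
      _ ≤ normList (c :: p) := by
        simp only [normList, Int.cast_add, Int.natCast_natAbs, Int.cast_abs]; linarith

theorem abs_intCast_sub_mul_ediv_le (c : ℤ) {m : ℤ} (hm : 0 < m) :
    |(c : ℝ) - m * (c / m : ℤ)| ≤ m := by
  have h1 := Int.emod_nonneg c hm.ne'
  have h2 := Int.emod_lt_of_pos c hm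
  have h3 : (c : ℝ) - m * (c / m : ℤ) = (c % m : ℤ) := by
    rw [Int.emod_def]; push_cast; ring
  rw [h3, abs_of_nonneg (by exact_mod_cast h1)]
  exact_mod_cast h2.le

/-- Long division from the constant term upwards: the quotient coefficient r contributes m r at the
current degree and r at the next, where it is carried as the new `b`. Each rounding costs at most m,
and since |z| ≤ 1 the costs just add up. -/
theorem abs_divList_le {m : ℤ} (hm : 0 < m) (b : ℤ) (p : List ℤ) {z : ℝ} (hz : |z| ≤ 1) :
    |evalList p z - b - (m + z) * evalList (divList m b p) z| ≤ divListErr m b p := by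
  induction p generalizing b with
  | nil => simp [evalList, divList, divListErr]
  | cons c p ih =>
    have h1 := abs_intCast_sub_mul_ediv_le (c - b) hm
    have h2 := ih ((c - b) / m)
    set r := (c - b) / m with hr
    set R := evalList p z - r - (m + z) * evalList (divList m r p) z
    have h3 : |z * R| ≤ 1 * divListErr m r p := by
      rw [abs_mul]; exact mul_le_mul hz h2 (abs_nonneg _) zero_le_one
    have h4 : evalList (c :: p) z - b - (m + z) * evalList (divList m b (c :: p)) z
        = ((c - b : ℤ) - m * r) + z * R := by
      simp only [evalList, divList, ← hr, R]; push_cast; ring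
    rw [h4]
    refine (abs_add_le _ _).trans ?_
    simp only [divListErr, ← hr]; push_cast at h1 ⊢; linarith

theorem abs_mulRound_le {S : ℤ} (hS : 0 < S) (f : ℤ) (p : List ℤ) {z : ℝ} (hz : |z| ≤ 1) :
    |(f / S : ℝ) * evalList p z - evalList (mulRound S f p) z| ≤ p.length := by
  have hS' : (0 : ℝ) < S := by exact_mod_cast hS
  induction p with
  | nil => simp [evalList, mulRound]
  | cons c p ih =>
    have h1 := abs_intCast_sub_mul_ediv_le (c * f) hS
    set R := (f / S : ℝ) * evalList p z - evalList (mulRound S f p) z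
    have h3 : |z * R| ≤ 1 * p.length := by
      rw [abs_mul]; exact mul_le_mul hz ih (abs_nonneg _) zero_le_one
    have h4 : (f / S : ℝ) * evalList (c :: p) z - evalList (mulRound S f (c :: p)) z
        = ((c * f : ℤ) - S * (c * f / S : ℤ)) / S + z * R := by
      simp only [evalList, mulRound, R, List.map_cons]; push_cast; field_simp; ring
    rw [h4]
    refine (abs_add_le _ _).trans ?_
    have h5 : |(((c * f : ℤ) : ℝ) - S * (c * f / S : ℤ)) / S| ≤ 1 := by
      rw [abs_div, abs_of_pos hS', div_le_one hS']; exact h1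
    push_cast [List.length_cons] at h5 ⊢; linarith

/-- Fixed-point Horner scheme for `w * F (z')` with `z' = (4 - m - z) / (m + z)`, where `U`
approximates `w` up to `e`; the second component bounds the error. -/
def hornerList (S m : ℤ) (U : List ℤ) (e : ℤ) : List ℤ → List ℤ × ℤ
  | [] => ([], 0)
  | f :: F =>
    (addList (addList (divList m 0 ((hornerList S m U e F).1.map (4 * ·)))
        ((hornerList S m U e F).1.map (-1 * ·))) (mulRound S f U),
      (hornerList S m U e F).2 + divListErr m 0 ((hornerList S m U e F).1.map (4 * ·))
        + e + U.length)

/-- With y = 4 / (m + z) - 1, one Horner step is w (f + y F(y)) = y (w F(y)) + f w, so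
multiplication by y is a division by m + z and a subtraction. As m + z ≥ 2, |y| ≤ 1 and earlier
errors do not grow. -/
theorem abs_hornerList_le {S m : ℤ} (hS : 0 < S) (hm : 3 ≤ m) {U : List ℤ} {e : ℤ} {w z : ℝ}
    (hz : |z| ≤ 1) (hU : |S * w - evalList U z| ≤ e) (F : List ℤ) (hF : ∀ f ∈ F, |f| ≤ S) :
    |w * evalList F ((4 - m - z) / (m + z)) - evalList (hornerList S m U e F).1 z|
      ≤ (hornerList S m U e F).2 := by
  have hS' : (0 : ℝ) < S := by exact_mod_cast hS
  have hm' : (3 : ℝ) ≤ m := by exact_mod_cast hm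
  have hz' := abs_le.1 hz
  have hmz : 2 ≤ m + z := by linarith
  induction F with
  | nil => simp [evalList, hornerList]
  | cons f F ih =>
    have ih := ih fun g hg => hF g (List.mem_cons_of_mem _ hg)
    have hf : |(f : ℝ)| ≤ S := by exact_mod_cast hF f List.mem_cons_self
    set p := (hornerList S m U e F).1
    set ep := (hornerList S m U e F).2
    set y := (4 - m - z) / (m + z) with hy
    have hy1 : |y| ≤ 1 := by
      rw [hy, abs_div, abs_of_pos (show 0 < m + z by linarith), div_le_one (by linarith), abs_le]
      constructor <;> linarith
    set R := w * evalList F y - evalList p z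
    have h1 : |y * R| ≤ 1 * ep := by
      rw [abs_mul]; exact mul_le_mul hy1 ih (abs_nonneg _) zero_le_one
    have h2 := abs_divList_le (m := m) (by omega) 0 (p.map (4 * ·)) hz
    rw [evalList_map_mul] at h2
    set d := divList m 0 (p.map (4 * ·)) with hd
    have h3 : |((4 : ℤ) * evalList p z - (0 : ℤ) - (m + z) * evalList d z) / (m + z)|
        ≤ divListErr m 0 (p.map (4 * ·)) := by
      rw [abs_div, abs_of_pos (show 0 < m + z by linarith)]
      exact (div_le_self (abs_nonneg _) (by linarith)).trans h2
    have h4 : |(f / S : ℝ) * (S * w - evalList U z)| ≤ 1 * e := by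
      rw [abs_mul]
      refine mul_le_mul ?_ hU (abs_nonneg _) zero_le_one
      rw [abs_div, abs_of_pos hS', div_le_one hS']; exact hf
    have h5 := abs_mulRound_le hS f U hz
    have h6 : w * evalList (f :: F) y - evalList (hornerList S m U e (f :: F)).1 z
        = y * R + ((4 : ℤ) * evalList p z - (0 : ℤ) - (m + z) * evalList d z) / (m + z)
          + (f / S : ℝ) * (S * w - evalList U z)
          + ((f / S : ℝ) * evalList U z - evalList (mulRound S f U) z) := by
      simp only [hornerList, evalList_addList, evalList_map_mul, evalList, R]
      change w * (f + y * evalList F y)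
        - (evalList d z + ((-1 : ℤ) : ℝ) * evalList p z + evalList (mulRound S f U) z) = _
      rw [hy]; push_cast; field_simp; ring
    rw [h6]
    refine (abs_add_le _ _).trans ?_
    refine (add_le_add_left (abs_add_le _ _) _).trans ?_
    refine (add_le_add_left (add_le_add_left (abs_add_le _ _) _) _).trans ?_
    change _ ≤ ((ep + divListErr m 0 (p.map (4 * ·)) + e + U.length : ℤ) : ℝ)
    push_cast; linarith

/-! ### Powers `(a + x) ^ (-s)` as fixed-point polynomials in `z = 2 x - 1` -/

/-- Rounded Taylor coefficients of a multiple of `(m + z) ^ (-p / q)`, from the `k`-th one on. -/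
def powCoeffs (p q m : ℤ) : ℕ → ℤ → ℤ → List ℤ
  | 0, _, _ => []
  | n + 1, k, u => u :: powCoeffs p q m n (k + 1) (-((p + k * q) * u) / (m * (k + 1) * q))

/-- The residual of `U` in the differential equation `q (m + z) U' + p U = 0`. -/
def powResidual (p q m : ℤ) (U : List ℤ) : List ℤ :=
  addList (addList ((derivList U).map (q * m * ·)) (0 :: (derivList U).map (q * ·)))
    (U.map (p * ·))

def evalInt : List ℤ → ℤ → ℤ
  | [], _ => 0
  | c :: p, z => c + z * evalInt p z

theorem evalList_intCast (p : List ℤ) (z : ℤ) : evalList p z = evalInt p z := by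
  induction p with
  | nil => simp [evalList, evalInt]
  | cons c p ih => simp [evalList, evalInt, ih]

theorem evalList_powResidual (p q m : ℤ) (U : List ℤ) (z : ℝ) :
    evalList (powResidual p q m U) z
      = q * (m + z) * evalList (derivList U) z + p * evalList U z := by
  simp only [powResidual, evalList_addList, evalList_map_mul, evalList]
  push_cast; ring

/-- Error of `U` as an approximation of `(a + x) ^ (-p / q)`, given the value `v` at `x = 0` up
to `e`. -/
def powErr (p q a : ℤ) (U : List ℤ) (v e : ℤ) : ℤ :=
  (evalInt U (-1) - v).natAbs + e + 2 * (normList (powResidual p q (2 * a + 1) U) / q + 1)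

/-- If U were exactly a multiple of (m + z)^(-s), with m = 2a + 1, the product would be constant. In
general its derivative is a power times the residual, and the mean value inequality applies on an
interval of length 2. -/
theorem abs_rpow_mul_evalList_sub_le {p q : ℤ} (hq : 0 < q) (hpq : q ≤ p) (hpq' : p ≤ 2 * q)
    {a : ℤ} (ha : 1 ≤ a) (U : List ℤ) {z : ℝ} (hz : |z| ≤ 1) :
    |((2 * a + 1 + z) / 2) ^ (p / q : ℝ) * evalList U z - (a : ℝ) ^ (p / q : ℝ) * evalList U (-1)|
      ≤ (a + 1) * (normList (powResidual p q (2 * a + 1) U) / q : ℝ) := by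
  have hq' : (0 : ℝ) < q := by exact_mod_cast hq
  have ha' : (1 : ℝ) ≤ a := by exact_mod_cast ha
  have hs1 : (1 : ℝ) ≤ p / q := by rw [le_div_iff₀ hq', one_mul]; exact_mod_cast hpq
  have hs2 : (p / q : ℝ) ≤ 2 := by rw [div_le_iff₀ hq']; exact_mod_cast hpq'
  set s : ℝ := p / q with hs
  set R := powResidual p q (2 * a + 1) U with hR
  have hb : ∀ y ∈ Set.Icc (-1 : ℝ) 1, HasDerivWithinAt
      (fun y => ((2 * a + 1 + y) / 2) ^ s * evalList U y)
      (((2 * a + 1 + y) / 2) ^ (s - 1) * (evalList R y / (2 * q))) (Set.Icc (-1) 1) y := by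
    intro y hy
    have hpos : 0 < (2 * a + 1 + y) / 2 := by linarith [hy.1]
    have h1 : HasDerivAt (fun y : ℝ => (2 * a + 1 + y) / 2) (1 / 2) y :=
      ((hasDerivAt_id y).const_add _).div_const 2
    have h2 := (h1.rpow_const (p := s) (Or.inl hpos.ne')).mul (hasDerivAt_evalList U y)
    refine (h2.congr_deriv ?_).hasDerivWithinAt
    have h3 : ((2 * a + 1 + y) / 2) ^ s = ((2 * a + 1 + y) / 2) ^ (s - 1) * ((2 * a + 1 + y) / 2) := by
      rw [← Real.rpow_add_one hpos.ne']; simp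
    rw [h3, hR, evalList_powResidual]
    push_cast
    rw [hs]; field_simp; ring
  have hbd : ∀ y ∈ Set.Icc (-1 : ℝ) 1,
      ‖((2 * a + 1 + y) / 2) ^ (s - 1) * (evalList R y / (2 * q))‖
        ≤ (a + 1) * (normList R / (2 * q)) := by
    intro y hy
    have hpos : 1 ≤ (2 * a + 1 + y) / 2 := by linarith [hy.1]
    rw [norm_mul, Real.norm_of_nonneg (by positivity), Real.norm_eq_abs, abs_div,
      abs_of_pos (show (0 : ℝ) < 2 * q by linarith)]
    have h1 : ((2 * a + 1 + y) / 2) ^ (s - 1) ≤ a + 1 := by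
      calc ((2 * a + 1 + y) / 2) ^ (s - 1) ≤ ((2 * a + 1 + y) / 2) ^ (1 : ℝ) :=
            Real.rpow_le_rpow_of_exponent_le hpos (by linarith)
        _ ≤ a + 1 := by rw [Real.rpow_one]; linarith [hy.2]
    have h2 := abs_evalList_le R (z := y) (abs_le.2 hy)
    gcongr
  have h := Convex.norm_image_sub_le_of_norm_hasDerivWithin_le hb hbd (convex_Icc (-1 : ℝ) 1)
    (show (-1 : ℝ) ∈ Set.Icc (-1 : ℝ) 1 by norm_num) (abs_le.1 hz)
  have h0 : (2 * (a : ℝ) + 1 + -1) / 2 = a := by ring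
  rw [h0, Real.norm_eq_abs, Real.norm_eq_abs] at h
  refine h.trans ?_
  have hz2 : |z - -1| ≤ 2 := by
    rw [abs_le] at hz ⊢; constructor <;> linarith
  have hN : (0 : ℝ) ≤ normList R := (abs_nonneg _).trans (abs_evalList_le R (z := 0) (by simp))
  calc (a + 1) * (normList R / (2 * q)) * |z - -1|
      ≤ (a + 1) * (normList R / (2 * q)) * 2 := by gcongr
    _ = (a + 1) * (normList R / q : ℝ) := by field_simp

/-- The bound is a posteriori: U is arbitrary, and its error is controlled by the residual and by
its value at z = -1, where the base is a. The 2 in `powErr` comes from a^(-s) (a + 1) ≤ 1 + 1/a ≤ 2.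
-/
theorem abs_rpow_sub_evalList_le {S p q : ℤ} (hq : 0 < q) (hpq : q ≤ p) (hpq' : p ≤ 2 * q)
    {a : ℤ} (ha : 1 ≤ a) (U : List ℤ) {v e : ℤ} (hv : |S * (a : ℝ) ^ (-(p / q : ℝ)) - v| ≤ e)
    {z : ℝ} (hz : |z| ≤ 1) :
    |S * ((2 * a + 1 + z) / 2) ^ (-(p / q : ℝ)) - evalList U z| ≤ powErr p q a U v e := by
  have hq' : (0 : ℝ) < q := by exact_mod_cast hq
  have ha' : (1 : ℝ) ≤ a := by exact_mod_cast ha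
  have hs1 : (1 : ℝ) ≤ p / q := by rw [le_div_iff₀ hq', one_mul]; exact_mod_cast hpq
  have h1 := abs_rpow_mul_evalList_sub_le hq hpq hpq' ha U hz
  set s : ℝ := p / q with hs
  set N := normList (powResidual p q (2 * a + 1) U) with hN
  have hz' := abs_le.1 hz
  have hN0 : (0 : ℝ) ≤ N := (abs_nonneg _).trans (abs_evalList_le _ (z := 0) (by simp))
  set x : ℝ := (2 * a + 1 + z) / 2 with hx
  have hxa : (a : ℝ) ≤ x := by rw [hx]; linarith
  have hx0 : 0 < x := by linarith
  have ha0 : (0 : ℝ) < a := by linarith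
  have hxs : x ^ (-s) * x ^ s = 1 := by rw [← Real.rpow_add hx0]; simp
  have has : (a : ℝ) ^ (-s) * (a : ℝ) ^ s = 1 := by rw [← Real.rpow_add ha0]; simp
  have hle : x ^ (-s) ≤ (a : ℝ) ^ (-s) := Real.rpow_le_rpow_of_nonpos ha0 hxa (by linarith)
  have hinv : (a : ℝ) ^ (-s) * (a + 1) ≤ 2 := by
    calc (a : ℝ) ^ (-s) * (a + 1) ≤ (a : ℝ) ^ (-1 : ℝ) * (a + 1) := by
          gcongr
      _ = 1 + (a : ℝ)⁻¹ := by rw [Real.rpow_neg_one]; field_simp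
      _ ≤ 2 := by linarith [inv_le_one_of_one_le₀ ha']
  have hU1 : evalList U (-1) = evalInt U (-1) := by
    rw [← evalList_intCast]; norm_num
  set G := x ^ s * evalList U z
  set G0 := (a : ℝ) ^ s * evalList U (-1) with hG0
  have e1 : S * x ^ (-s) - evalList U z = x ^ (-s) * ((S - G0) - (G - G0)) := by
    have : x ^ (-s) * G = evalList U z := by simp only [G]; rw [← mul_assoc, hxs, one_mul]
    rw [← this]; ring
  have e2 : (a : ℝ) ^ (-s) * (S - G0)
      = (S * (a : ℝ) ^ (-s) - v) - ((evalInt U (-1) : ℝ) - v) := by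
    have : (a : ℝ) ^ (-s) * G0 = evalInt U (-1) := by rw [hG0, ← mul_assoc, has, one_mul, hU1]
    rw [mul_sub, this]; ring
  have e3 : (a : ℝ) ^ (-s) * |S - G0| ≤ e + |(evalInt U (-1) : ℝ) - v| := by
    rw [← abs_of_pos (Real.rpow_pos_of_pos ha0 (-s)), ← abs_mul, e2]
    refine (abs_sub _ _).trans ?_
    linarith
  have e4 : (N / q : ℝ) ≤ (N / q : ℤ) + 1 := by
    have := abs_intCast_sub_mul_ediv_le N hq
    rw [div_le_iff₀ hq']
    linarith [(abs_le.1 this).2]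
  calc |S * x ^ (-s) - evalList U z| ≤ x ^ (-s) * (|S - G0| + |G - G0|) := by
        rw [e1, abs_mul, abs_of_pos (Real.rpow_pos_of_pos hx0 _)]
        gcongr; exact abs_sub _ _
    _ ≤ (a : ℝ) ^ (-s) * (|S - G0| + (a + 1) * (N / q)) := by gcongr
    _ = (a : ℝ) ^ (-s) * |S - G0| + (a : ℝ) ^ (-s) * (a + 1) * (N / q) := by ring
    _ ≤ (e + |(evalInt U (-1) : ℝ) - v|) + 2 * (N / q) := by gcongr
    _ ≤ powErr p q a U v e := by
        simp only [powErr, ← hN]; push_cast [Int.natCast_natAbs, Int.cast_abs]; linarith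

/-! ### The transfer operator -/

/-- Fixed-point approximation of `∑ (a + x) ^ (-p / q) * F (1 / (a + x))` over successive digits
starting from `a`, one for each leading coefficient in the last argument; `v` is the value of
`a ^ (-p / q)` up to `e`. -/
def transferList (S p q : ℤ) (F : List ℤ) : ℤ → ℤ → ℤ → List ℤ → List ℤ × ℤ
  | _, _, _, [] => ([], 0)
  | a, v, e, u :: us =>
    let U := powCoeffs p q (2 * a + 1) F.length 0 u
    let e' := powErr p q a U v e
    let h := hornerList S (2 * a + 1) U e' F
    let r := transferList S p q F (a + 1) (evalInt U 1) e' us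
    (addList h.1 r.1, h.2 + r.2)

/-- The digits are chained: at z = 1 the polynomial for the digit a approximates (a + 1)^(-s), which
is the initial value required for the next digit. Hence no power has to be known beforehand except
the first. -/
theorem abs_transferList_le {S p q : ℤ} (hS : 0 < S) (hq : 0 < q) (hpq : q ≤ p)
    (hpq' : p ≤ 2 * q) {F : List ℤ} (hF : ∀ f ∈ F, |f| ≤ S) {x : ℝ} (hx : x ∈ Set.Icc (0 : ℝ) 1)
    (us : List ℤ) (a : ℕ) (ha : 1 ≤ a) (v e : ℤ) (hv : |S * (a : ℝ) ^ (-(p / q : ℝ)) - v| ≤ e) :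
    |∑ i ∈ Finset.range us.length, ((a + i : ℕ) + x) ^ (-(p / q : ℝ))
          * evalList F (2 * (1 / ((a + i : ℕ) + x)) - 1)
        - evalList (transferList S p q F a v e us).1 (2 * x - 1)|
      ≤ (transferList S p q F a v e us).2 := by
  induction us generalizing a v e with
  | nil => simp [transferList, evalList]
  | cons u us ih =>
    have hz : |2 * x - 1| ≤ 1 := abs_le.2 ⟨by linarith [hx.1], by linarith [hx.2]⟩
    simp only [transferList]
    set U := powCoeffs p q (2 * a + 1) F.length 0 u
    set e' := powErr p q a U v e with he'
    have ha1 : (1 : ℤ) ≤ a := by exact_mod_cast ha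
    have hU : ∀ z : ℝ, |z| ≤ 1 →
        |S * ((2 * a + 1 + z) / 2) ^ (-(p / q : ℝ)) - evalList U z| ≤ e' := fun z hz =>
      abs_rpow_sub_evalList_le hq hpq hpq' ha1 U hv hz
    have h1 := abs_hornerList_le (m := 2 * a + 1) hS (by omega) hz (hU _ hz) F hF
    have h2 := ih (a + 1) (by omega) (evalInt U 1) e' (by
      have := hU 1 (by simp)
      have h3 : (2 * (a : ℝ) + 1 + 1) / 2 = (a + 1 : ℕ) := by push_cast; ring
      have h4 := evalList_intCast U 1
      rw [Int.cast_one] at h4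
      rw [h3, h4] at this
      exact this)
    have hax : (0 : ℝ) < a + x := by
      have : (1 : ℝ) ≤ a := by exact_mod_cast ha
      linarith [hx.1]
    have e1 : (2 * (a : ℝ) + 1 + (2 * x - 1)) / 2 = a + x := by ring
    have e2 : (4 - ((2 * a + 1 : ℤ) : ℝ) - (2 * x - 1)) / (((2 * a + 1 : ℤ) : ℝ) + (2 * x - 1))
        = 2 * (1 / (a + x)) - 1 := by
      push_cast
      rw [show (2 * (a : ℝ) + 1 + (2 * x - 1)) = 2 * (a + x) by ring]
      field_simp
      ring
    rw [e1, e2] at h1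
    rw [List.length_cons, Finset.sum_range_succ', evalList_addList]
    have e3 : ∀ i : ℕ, a + (i + 1) = a + 1 + i := fun i => by ring
    rw [Finset.sum_congr rfl fun i _ => by rw [e3 i], add_zero]
    push_cast at h2 ⊢
    rw [add_comm (∑ _ ∈ _, _), add_sub_add_comm]
    refine (abs_add_le _ _).trans (add_le_add h1 ?_)
    exact h2

/-! ### Integer certificates for the test function -/

/-- Lower bound on `[-1, 1]` of the polynomial with the given coefficients. -/
def lowerList : List ℤ → ℤ
  | [] => 0
  | c :: p => c - normList p

theorem lowerList_le (p : List ℤ) {z : ℝ} (hz : |z| ≤ 1) : lowerList p ≤ evalList p z := by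
  cases p with
  | nil => simp [lowerList, evalList]
  | cons c p =>
    have h : |z * evalList p z| ≤ 1 * normList p := by
      rw [abs_mul]; exact mul_le_mul hz (abs_evalList_le p hz) (abs_nonneg _) zero_le_one
    simp only [lowerList, evalList]; push_cast; linarith [(abs_le.1 h).1]

/-- Taylor coefficients, in `2 x - 1`, of an approximate eigenfunction of the transfer operator. -/
def eigenCoeffs : List ℤ := [
  100000000000000000000, -31708988764996228994, 9072259900150956911, -2587919473433696445,
  744827593244635372, -216006190027590040, 62968620836472923, -18419606941131116,
  5401088905943162, -1586578427249459, 466726637701819, -137462713357097, 40528549353090,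
  -11960277276295, 3532529408498, -1044145814373, 308843173416, -91409258619, 27070369381,
  -8021005748, 2377798732, -705205825, 209235765, -62104274, 18439975, -5476985, 1627253,
  -483607, 143762, -42748, 12713, -3783, 1125, -335, 99, -30, 8, -3]

/-- Approximations of 10^20 (a + 1/2)^(-s), a = 1, …, 5, at the exponent of the lower bound: the
constant terms at z = 0. Nothing is assumed about them, since `powErr` measures their error. -/
def powInitLower : List ℤ := [
  50732153671686500374, 21576657502885747657, 12286146293572841104, 8067613257621673640,
  5766142949486204523]

def powInitUpper : List ℤ := [
  50732153671604219901, 21576657502806665692, 12286146293511274587, 8067613257573136381,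
  5766142949446885238]

theorem eigenCoeffs_bounds :
    (∀ f ∈ eigenCoeffs, |f| ≤ 10 ^ 20) ∧ 0 < lowerList eigenCoeffs := by
  decide +kernel

theorem transferList_lower :
    let T := transferList (10 ^ 20) 5230184023 3125000000 eigenCoeffs 1 (10 ^ 20) 0 powInitLower
    T.2 < lowerList (addList T.1 (eigenCoeffs.map (-1 * ·))) := by
  decide +kernel

theorem transferList_upper :
    let T := transferList (10 ^ 20) 418414721841 250000000000 eigenCoeffs 1 (10 ^ 20) 0 powInitUpper
    T.2 < lowerList (addList eigenCoeffs (T.1.map (-1 * ·))) := by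
  decide +kernel

/-! ### Continued fraction maps -/

/-- The map `x ↦ 1 / (a₁ + 1 / (a₂ + ⋯ + 1 / (aₙ + x)))`. -/
noncomputable def cfMap : List ℕ → ℝ → ℝ
  | [], x => x
  | a :: w, x => 1 / (a + cfMap w x)

/-- The denominator of the Möbius map `cfMap w`: the derivative of `cfMap w` is `± 1 / cfDen w ^ 2`. -/
noncomputable def cfDen : List ℕ → ℝ → ℝ
  | [], _ => 1
  | a :: w, x => (a + cfMap w x) * cfDen w x

/-- An interval mapped into itself by `x ↦ 1 / (a + x)` for all `a ∈ {1, …, m}`. -/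
def cfInterval (m : ℕ) : Set ℝ := Set.Icc (1 / (m + 1)) ((m + 1) / (m + 2))

theorem cfInterval_subset (m : ℕ) : cfInterval m ⊆ Set.Icc 0 1 := by
  refine Set.Icc_subset_Icc (by positivity) ?_
  rw [div_le_one (by positivity)]; linarith

theorem left_mem_cfInterval {m : ℕ} (hm : 1 ≤ m) : (1 / (m + 1) : ℝ) ∈ cfInterval m := by
  refine ⟨le_rfl, ?_⟩
  have : (1 : ℝ) ≤ m := by exact_mod_cast hm
  rw [div_le_div_iff₀ (by positivity) (by positivity)]; nlinarith

theorem one_div_add_mem_cfInterval {m a : ℕ} (ha : a ∈ Set.Icc 1 m) {x : ℝ}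
    (hx : x ∈ cfInterval m) : 1 / (a + x) ∈ cfInterval m := by
  have h1 : (1 : ℝ) ≤ a := by exact_mod_cast ha.1
  have h2 : (a : ℝ) ≤ m := by exact_mod_cast ha.2
  have hx' := cfInterval_subset m hx
  have hx1 : 1 / ((m : ℝ) + 1) ≤ x := hx.1
  constructor
  · exact one_div_le_one_div_of_le (by linarith [hx'.1]) (by linarith [hx'.2])
  · rw [show ((m : ℝ) + 1) / (m + 2) = 1 / (1 + 1 / (m + 1)) by field_simp; ring]
    exact one_div_le_one_div_of_le (by positivity) (by linarith)

theorem cfMap_mem_cfInterval {m : ℕ} {w : List ℕ} (hw : ∀ a ∈ w, a ∈ Set.Icc 1 m) {x : ℝ}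
    (hx : x ∈ cfInterval m) : cfMap w x ∈ cfInterval m := by
  induction w with
  | nil => exact hx
  | cons a w ih =>
    exact one_div_add_mem_cfInterval (hw a List.mem_cons_self)
      (ih fun b hb => hw b (List.mem_cons_of_mem _ hb))

theorem cfMap_nonneg (w : List ℕ) {x : ℝ} (hx : 0 ≤ x) : 0 ≤ cfMap w x := by
  induction w with
  | nil => exact hx
  | cons a w ih => exact one_div_nonneg.2 (by positivity)

theorem cfDen_pos {w : List ℕ} (hw : ∀ a ∈ w, 1 ≤ a) {x : ℝ} (hx : 0 ≤ x) : 0 < cfDen w x := by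
  induction w with
  | nil => exact one_pos
  | cons a w ih =>
    have h1 : (1 : ℝ) ≤ a := by exact_mod_cast hw a List.mem_cons_self
    exact mul_pos (by linarith [cfMap_nonneg w hx]) (ih fun b hb => hw b (List.mem_cons_of_mem _ hb))

/-- Each branch divides a difference by (a + u)(a + v), and these factors multiply up to the two
denominators. -/
theorem abs_cfMap_sub {w : List ℕ} (hw : ∀ a ∈ w, 1 ≤ a) {x y : ℝ} (hx : 0 ≤ x) (hy : 0 ≤ y) :
    |cfMap w x - cfMap w y| = |x - y| / (cfDen w x * cfDen w y) := by
  induction w with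
  | nil => simp [cfMap, cfDen]
  | cons a w ih =>
    have hw' := fun b hb => hw b (List.mem_cons_of_mem _ hb)
    have h1 : (1 : ℝ) ≤ a := by exact_mod_cast hw a List.mem_cons_self
    have hx' : 0 < a + cfMap w x := by linarith [cfMap_nonneg w hx]
    have hy' : 0 < a + cfMap w y := by linarith [cfMap_nonneg w hy]
    have dx := cfDen_pos hw' hx
    have dy := cfDen_pos hw' hy
    have h2 : cfMap (a :: w) x - cfMap (a :: w) y
        = -(cfMap w x - cfMap w y) / ((a + cfMap w x) * (a + cfMap w y)) := by
      simp only [cfMap]; field_simp; ring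
    rw [h2, abs_div, abs_neg, ih hw', abs_of_pos (mul_pos hx' hy')]
    simp only [cfDen]; field_simp

/-- The Möbius coefficients of `cfMap w`. B ≤ A yields bounded distortion; B + D ≤ A + C is there to
keep B ≤ A in the induction. -/
theorem exists_cfDen_eq {w : List ℕ} (hw : ∀ a ∈ w, 1 ≤ a) :
    ∃ A B C D : ℝ, 0 ≤ B ∧ B ≤ A ∧ 0 ≤ D ∧ B + D ≤ A + C ∧
      ∀ x, 0 ≤ x → cfDen w x = A + B * x ∧ cfMap w x * cfDen w x = C + D * x := by
  induction w with
  | nil => exact ⟨1, 0, 0, 1, by simp, by simp, by simp, by simp, fun x _ => by simp [cfDen, cfMap]⟩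
  | cons a w ih =>
    obtain ⟨A, B, C, D, hB, hBA, hD, hs, h⟩ := ih fun b hb => hw b (List.mem_cons_of_mem _ hb)
    have h1 : (1 : ℝ) ≤ a := by exact_mod_cast hw a List.mem_cons_self
    refine ⟨a * A + C, a * B + D, A, B, by positivity, by nlinarith, hB, by nlinarith,
      fun x hx => ?_⟩
    obtain ⟨e1, e2⟩ := h x hx
    have hx' : a + cfMap w x ≠ 0 := by linarith [cfMap_nonneg w hx]
    constructor
    · rw [cfDen, add_mul, e1, ← e1, e2, e1]; ring
    · rw [cfMap, cfDen, ← e1]; field_simp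

theorem cfDen_le_two_mul {w : List ℕ} (hw : ∀ a ∈ w, 1 ≤ a) {x y : ℝ} (hx : x ∈ Set.Icc (0 : ℝ) 1)
    (hy : y ∈ Set.Icc (0 : ℝ) 1) : cfDen w x ≤ 2 * cfDen w y := by
  obtain ⟨A, B, C, D, hB, hBA, -, -, h⟩ := exists_cfDen_eq hw
  rw [(h x hx.1).1, (h y hy.1).1]
  nlinarith [mul_le_mul_of_nonneg_left hx.2 hB, mul_nonneg hB hy.1]

/-- Strict expansion needs points away from 0, since x ↦ 1/(1+x) has derivative -1 there; this is
why `cfInterval` replaces [0,1]. -/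
theorem pow_le_cfDen {m : ℕ} {w : List ℕ} (hw : ∀ a ∈ w, a ∈ Set.Icc 1 m) {x : ℝ}
    (hx : x ∈ cfInterval m) : (1 + 1 / (m + 1) : ℝ) ^ w.length ≤ cfDen w x := by
  induction w with
  | nil => simp [cfDen]
  | cons a w ih =>
    have hw' := fun b hb => hw b (List.mem_cons_of_mem _ hb)
    have h1 : (1 : ℝ) ≤ a := by exact_mod_cast (hw a List.mem_cons_self).1
    have h2 := (cfMap_mem_cfInterval hw' hx).1
    rw [List.length_cons, pow_succ', cfDen]
    exact mul_le_mul (by linarith) (ih hw') (by positivity) (by linarith [show (0:ℝ) ≤ 1 / (m + 1) by positivity])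

theorem cfMap_append (v w : List ℕ) (x : ℝ) : cfMap (v ++ w) x = cfMap v (cfMap w x) := by
  induction v with
  | nil => rfl
  | cons a v ih => simp [cfMap, ih]

/-! ### Values of infinite continued fractions -/

/-- The first `n` terms of a sequence. -/
def seqPrefix (a : ℕ → ℕ) (n : ℕ) : List ℕ := List.ofFn fun i : Fin n => a i

theorem seqPrefix_succ (a : ℕ → ℕ) (n : ℕ) :
    seqPrefix a (n + 1) = a 0 :: seqPrefix (fun k => a (k + 1)) n := by
  simp [seqPrefix, List.ofFn_succ]

theorem length_seqPrefix (a : ℕ → ℕ) (n : ℕ) : (seqPrefix a n).length = n := by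
  simp [seqPrefix]

theorem mem_of_mem_seqPrefix {s : Set ℕ} {a : ℕ → ℕ} (ha : ∀ n, a n ∈ s) (n : ℕ) :
    ∀ b ∈ seqPrefix a n, b ∈ s := by
  intro b hb
  obtain ⟨i, rfl⟩ := List.mem_ofFn.1 hb
  exact ha i

theorem seqPrefix_add (a : ℕ → ℕ) (n k : ℕ) :
    seqPrefix a (n + k) = seqPrefix a n ++ seqPrefix (fun j => a (j + n)) k := by
  induction n generalizing a with
  | zero => simp [seqPrefix]
  | succ n ih =>
    rw [Nat.add_right_comm, seqPrefix_succ, ih, seqPrefix_succ, List.cons_append]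
    rfl

theorem convs_regularContFract {a : ℕ → ℕ} (ha : ∀ n, 1 ≤ a n) (n : ℕ) :
    (regularContFract a).convs n = cfMap (seqPrefix a n) 0 := by
  have hs : ∀ {a : ℕ → ℕ} {k : ℕ}, (regularContFract a).s.get? k = some ⟨1, (a k : ℝ)⟩ := by
    intro a k; rfl
  rw [GenContFract.convs_eq_convs']
  · have key : ∀ (n : ℕ) (a : ℕ → ℕ),
        GenContFract.convs'Aux (regularContFract a).s n = cfMap (seqPrefix a n) 0 := by
      intro n
      induction n with
      | zero => intro a; simp [GenContFract.convs'Aux, seqPrefix, cfMap]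
      | succ n ih =>
        intro a
        have h0 : (regularContFract a).s.head = some ⟨1, (a 0 : ℝ)⟩ := rfl
        have ht : (regularContFract a).s.tail = (regularContFract fun k => a (k + 1)).s := rfl
        rw [GenContFract.convs'Aux_succ_some h0, ht, ih, seqPrefix_succ, cfMap]
    rw [GenContFract.convs', key]
    simp [regularContFract]
  · intro gp k _ hk
    rw [hs] at hk
    obtain rfl := Option.some.inj hk
    exact ⟨one_pos, Nat.cast_pos.2 (ha k)⟩

theorem abs_cfMap_sub_le {m : ℕ} {w : List ℕ} (hw : ∀ a ∈ w, a ∈ Set.Icc 1 m) {x y : ℝ}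
    (hx : x ∈ cfInterval m) (hy : y ∈ cfInterval m) :
    |cfMap w x - cfMap w y| ≤ ((1 + 1 / (m + 1) : ℝ)⁻¹) ^ w.length := by
  have hx' := cfInterval_subset m hx
  have hy' := cfInterval_subset m hy
  rw [abs_cfMap_sub (fun a ha => (hw a ha).1) hx'.1 hy'.1, inv_pow, ← one_div]
  have h1 := pow_le_cfDen hw hx
  have h2 := pow_le_cfDen hw hy
  have h3 : (1 : ℝ) ≤ (1 + 1 / (m + 1) : ℝ) ^ w.length :=
    one_le_pow₀ (by linarith [show (0:ℝ) ≤ 1 / (m + 1) by positivity])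
  have h4 : |x - y| ≤ 1 := by
    rw [abs_le]; constructor <;> linarith [hx'.1, hx'.2, hy'.1, hy'.2]
  refine div_le_div₀ zero_le_one h4 (by positivity) ?_
  nlinarith

theorem tendsto_ratio_pow (m : ℕ) :
    Tendsto (fun n : ℕ => ((1 + 1 / (m + 1) : ℝ)⁻¹) ^ n) atTop (𝓝 0) :=
  tendsto_pow_atTop_nhds_zero_of_lt_one (by positivity)
    (inv_lt_one_of_one_lt₀ (by linarith [show (0:ℝ) < 1 / (m + 1) by positivity]))

/-- The value of the infinite continued fraction with the given digits. -/
noncomputable def cfValue (a : ℕ → ℕ) : ℝ := limUnder atTop fun n => cfMap (seqPrefix a n) 0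

theorem exists_tendsto_cfMap {m : ℕ} {a : ℕ → ℕ} (ha : ∀ n, a n ∈ Set.Icc 1 m) :
    ∃ l ∈ cfInterval m, ∀ x : ℕ → ℝ, (∀ n, x n ∈ cfInterval m) →
      Tendsto (fun n => cfMap (seqPrefix a n) (x n)) atTop (𝓝 l) := by
  have hm : 1 ≤ m := (ha 0).1.trans (ha 0).2
  set x₀ : ℝ := 1 / (m + 1)
  have hx₀ : x₀ ∈ cfInterval m := left_mem_cfInterval hm
  have hmem := fun n => mem_of_mem_seqPrefix ha n
  have hc : CauchySeq fun n => cfMap (seqPrefix a n) x₀ := by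
    refine cauchySeq_of_le_geometric (1 + 1 / (m + 1) : ℝ)⁻¹ 1
      (inv_lt_one_of_one_lt₀ (by linarith [show (0:ℝ) < 1 / (m + 1) by positivity])) fun n => ?_
    rw [seqPrefix_add, cfMap_append, one_mul, Real.dist_eq]
    have := abs_cfMap_sub_le (hmem n) hx₀ (cfMap_mem_cfInterval
      (mem_of_mem_seqPrefix (fun j => ha (j + n)) 1) hx₀)
    rwa [length_seqPrefix] at this
  obtain ⟨l, hl⟩ := cauchySeq_tendsto_of_complete hc
  refine ⟨l, isClosed_Icc.mem_of_tendsto hl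
    (Eventually.of_forall fun n => cfMap_mem_cfInterval (hmem n) hx₀), fun x hx => ?_⟩
  have h : Tendsto (fun n => cfMap (seqPrefix a n) (x n) - cfMap (seqPrefix a n) x₀) atTop (𝓝 0) := by
    refine squeeze_zero_norm (fun n => ?_) (tendsto_ratio_pow m)
    have := abs_cfMap_sub_le (hmem n) (hx n) hx₀
    rwa [length_seqPrefix] at this
  simpa using h.add hl

theorem tendsto_cfMap_zero {m : ℕ} {a : ℕ → ℕ} (ha : ∀ n, a n ∈ Set.Icc 1 m) :
    cfValue a ∈ cfInterval m ∧
      Tendsto (fun n => cfMap (seqPrefix a n) 0) atTop (𝓝 (cfValue a)) ∧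
      ∀ x : ℕ → ℝ, (∀ n, x n ∈ cfInterval m) →
        Tendsto (fun n => cfMap (seqPrefix a n) (x n)) atTop (𝓝 (cfValue a)) := by
  obtain ⟨l, hl, h⟩ := exists_tendsto_cfMap ha
  have hm : 1 ≤ m := (ha 0).1.trans (ha 0).2
  have h0 : Tendsto (fun n => cfMap (seqPrefix a n) 0) atTop (𝓝 l) := by
    -- The point 0 lies outside `cfInterval m`, but two branches move it inside; the base points
    -- then vary with n.
    rw [← tendsto_add_atTop_iff_nat 2]
    have h1 := h (fun n => cfMap (seqPrefix (fun j => a (j + n)) 2) 0) fun n => ?_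
    · exact h1.congr fun n => by rw [seqPrefix_add, cfMap_append]
    · have e : cfMap (seqPrefix (fun j => a (j + n)) 2) 0
          = 1 / (a n + 1 / (a (1 + n) + 0)) := by
        simp [seqPrefix, cfMap, List.ofFn_succ]
      rw [e]
      have b1 : (1 : ℝ) ≤ a n := by exact_mod_cast (ha n).1
      have b2 : (a n : ℝ) ≤ m := by exact_mod_cast (ha n).2
      have c1 : (1 : ℝ) ≤ a (1 + n) := by exact_mod_cast (ha _).1
      have c2 : (a (1 + n) : ℝ) ≤ m := by exact_mod_cast (ha _).2
      have d1 : 1 / ((a (1 + n) : ℝ) + 0) ≤ 1 := by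
        rw [add_zero, div_le_one (by linarith)]; exact c1
      have d2 : 1 / ((m : ℝ) + 1) ≤ 1 / ((a (1 + n) : ℝ) + 0) :=
        one_div_le_one_div_of_le (by linarith) (by linarith)
      have d3 : (0 : ℝ) < 1 / ((m : ℝ) + 1) := by positivity
      constructor
      · exact one_div_le_one_div_of_le (by linarith) (by linarith)
      · rw [show ((m : ℝ) + 1) / (m + 2) = 1 / (1 + 1 / (m + 1)) by field_simp; ring]
        exact one_div_le_one_div_of_le (by positivity) (by linarith)
  have e : cfValue a = l := h0.limUnder_eq
  rw [e]
  exact ⟨hl, h0, h⟩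

theorem mem_contFractSet_iff {m : ℕ} {x : ℝ} :
    x ∈ contFractSet m ↔ ∃ a : ℕ → ℕ, (∀ n, a n ∈ Set.Icc 1 m) ∧ x = cfValue a := by
  refine exists_congr fun a => and_congr_right fun ha => ?_
  have h1 : (regularContFract a).convs = fun n => cfMap (seqPrefix a n) 0 :=
    funext fun n => convs_regularContFract (fun k => (ha k).1) n
  rw [h1]
  exact ⟨fun h => tendsto_nhds_unique h (tendsto_cfMap_zero ha).2.1,
    fun h => h ▸ (tendsto_cfMap_zero ha).2.1⟩

/-- Pass to the limit in the prefix decomposition; `cfMap` of a prefix is 1-Lipschitz on `cfInterval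
m` because its denominators are at least 1. -/
theorem cfValue_eq_cfMap {m : ℕ} {a : ℕ → ℕ} (ha : ∀ n, a n ∈ Set.Icc 1 m) (n : ℕ) :
    cfValue a = cfMap (seqPrefix a n) (cfValue fun j => a (j + n)) := by
  have hm : 1 ≤ m := (ha 0).1.trans (ha 0).2
  have hx₀ : (1 / (m + 1) : ℝ) ∈ cfInterval m := left_mem_cfInterval hm
  have h1 := (tendsto_cfMap_zero ha).2.2 (fun _ => 1 / (m + 1)) fun _ => hx₀
  obtain ⟨hl, -, h2⟩ := tendsto_cfMap_zero (a := fun j => a (j + n)) fun j => ha (j + n)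
  have h2 := h2 (fun _ => 1 / (m + 1)) fun _ => hx₀
  rw [← tendsto_add_atTop_iff_nat n] at h1
  refine tendsto_nhds_unique h1 ?_
  have hw := mem_of_mem_seqPrefix ha n
  have h3 := (h2.sub_const (cfValue fun j => a (j + n))).abs
  rw [sub_self, abs_zero] at h3
  rw [tendsto_iff_dist_tendsto_zero]
  refine squeeze_zero (fun _ => dist_nonneg) (fun k => ?_) h3
  rw [Real.dist_eq, add_comm, seqPrefix_add, cfMap_append]
  have hk := cfMap_mem_cfInterval (mem_of_mem_seqPrefix (fun j => ha (j + n)) k) hx₀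
  rw [abs_cfMap_sub (fun b hb => (hw b hb).1) (cfInterval_subset m hk).1 (cfInterval_subset m hl).1]
  refine div_le_self (abs_nonneg _) ?_
  have h5 : (1 : ℝ) ≤ (1 + 1 / (m + 1) : ℝ) ^ (seqPrefix a n).length :=
    one_le_pow₀ (by linarith [show (0:ℝ) ≤ 1 / (m + 1) by positivity])
  exact one_le_mul_of_one_le_of_one_le (h5.trans (pow_le_cfDen hw hk))
    (h5.trans (pow_le_cfDen hw hl))

/-! ### Sums over words -/

/-- The digits in `{1, …, m}` of a word over `Fin m`. -/
def wordDigits {m n : ℕ} (w : Fin n → Fin m) : List ℕ := List.ofFn fun i => (w i : ℕ) + 1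

theorem mem_wordDigits {m n : ℕ} (w : Fin n → Fin m) : ∀ a ∈ wordDigits w, a ∈ Set.Icc 1 m := by
  intro a ha
  obtain ⟨i, rfl⟩ := List.mem_ofFn.1 ha
  exact ⟨by omega, (w i).2⟩

theorem one_le_of_mem_wordDigits {m n : ℕ} (w : Fin n → Fin m) : ∀ a ∈ wordDigits w, 1 ≤ a :=
  fun a ha => (mem_wordDigits w a ha).1

theorem length_wordDigits {m n : ℕ} (w : Fin n → Fin m) : (wordDigits w).length = n := by
  simp [wordDigits]

theorem wordDigits_injective {m n : ℕ} : Function.Injective (wordDigits (m := m) (n := n)) := by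
  intro v w h
  have := List.ofFn_injective h
  funext i
  have := congrFun this i
  exact Fin.ext (by simpa using this)

/-- The transfer operator of the Gauss map restricted to the digits `{1, …, m}`. -/
noncomputable def transferOp (m : ℕ) (s : ℝ) (f : ℝ → ℝ) (x : ℝ) : ℝ :=
  ∑ i : Fin m, ((i : ℕ) + 1 + x) ^ (-s) * f (1 / ((i : ℕ) + 1 + x))

/-- For x ≥ 0 this is the n-th iterate of `transferOp m s` applied to f, written out over words. -/
noncomputable def wordSum (m n : ℕ) (s : ℝ) (f : ℝ → ℝ) (x : ℝ) : ℝ :=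
  ∑ w : Fin n → Fin m, cfDen (wordDigits w) x ^ (-s) * f (cfMap (wordDigits w) x)

theorem wordSum_zero (m : ℕ) (s : ℝ) (f : ℝ → ℝ) (x : ℝ) : wordSum m 0 s f x = f x := by
  simp [wordSum, wordDigits, cfDen, cfMap]

theorem wordSum_succ (m n : ℕ) (s : ℝ) (f : ℝ → ℝ) {x : ℝ} (hx : 0 ≤ x) :
    wordSum m (n + 1) s f x = wordSum m n s (transferOp m s f) x := by
  rw [wordSum, ← (Fin.consEquiv fun _ => Fin m).sum_comp, Fintype.sum_prod_type_right, wordSum]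
  refine Finset.sum_congr rfl fun w _ => ?_
  rw [transferOp, Finset.mul_sum]
  refine Finset.sum_congr rfl fun i _ => ?_
  have e : wordDigits (Fin.consEquiv (fun _ => Fin m) (i, w)) = ((i : ℕ) + 1) :: wordDigits w := by
    simp [wordDigits, Fin.consEquiv, List.ofFn_succ]
  have h1 := cfDen_pos (one_le_of_mem_wordDigits w) hx
  have h2 := cfMap_nonneg (wordDigits w) hx
  rw [e, cfDen, cfMap]
  push_cast
  rw [Real.mul_rpow (by positivity) h1.le]
  ring

theorem wordSum_mono {m n : ℕ} {s : ℝ} {f g : ℝ → ℝ} (h : ∀ x ∈ cfInterval m, f x ≤ g x) {x : ℝ}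
    (hx : x ∈ cfInterval m) : wordSum m n s f x ≤ wordSum m n s g x := by
  refine Finset.sum_le_sum fun w _ => mul_le_mul_of_nonneg_left
    (h _ (cfMap_mem_cfInterval (mem_wordDigits w) hx)) ?_
  exact Real.rpow_nonneg (cfDen_pos (one_le_of_mem_wordDigits w) (cfInterval_subset m hx).1).le _

theorem wordSum_const_mul (m n : ℕ) (s : ℝ) (f : ℝ → ℝ) (c x : ℝ) :
    wordSum m n s (fun y => c * f y) x = c * wordSum m n s f x := by
  rw [wordSum, wordSum, Finset.mul_sum]
  exact Finset.sum_congr rfl fun w _ => by ring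

theorem wordSum_le {m : ℕ} {s : ℝ} {f : ℝ → ℝ} (h : ∀ x ∈ cfInterval m, transferOp m s f x ≤ f x)
    (n : ℕ) {x : ℝ} (hx : x ∈ cfInterval m) : wordSum m n s f x ≤ f x := by
  induction n with
  | zero => rw [wordSum_zero]
  | succ n ih =>
    rw [wordSum_succ _ _ _ _ (cfInterval_subset m hx).1]
    exact (wordSum_mono h hx).trans ih

theorem le_wordSum {m : ℕ} {s c : ℝ} (hc : 0 ≤ c) {f : ℝ → ℝ}
    (h : ∀ x ∈ cfInterval m, c * f x ≤ transferOp m s f x)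
    (n : ℕ) {x : ℝ} (hx : x ∈ cfInterval m) : c ^ n * f x ≤ wordSum m n s f x := by
  induction n with
  | zero => rw [wordSum_zero]; simp
  | succ n ih =>
    rw [wordSum_succ _ _ _ _ (cfInterval_subset m hx).1]
    refine le_trans ?_ (wordSum_mono h hx)
    rw [wordSum_const_mul, pow_succ', mul_assoc]
    exact mul_le_mul_of_nonneg_left ih hc

/-! ### Upper bound for the dimension -/

theorem exists_word {m n : ℕ} {a : ℕ → ℕ} (ha : ∀ n, a n ∈ Set.Icc 1 m) :
    ∃ w : Fin n → Fin m, wordDigits w = seqPrefix a n := by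
  refine ⟨fun i => ⟨a i - 1, by have := (ha i).1; have := (ha i).2; omega⟩, ?_⟩
  rw [wordDigits, seqPrefix]
  congr 1
  funext i
  have := (ha i).1
  simp only; omega

theorem contFractSet_subset_iUnion (m n : ℕ) :
    contFractSet m ⊆ ⋃ w : Fin n → Fin m, cfMap (wordDigits w) '' cfInterval m := by
  intro x hx
  obtain ⟨a, ha, rfl⟩ := mem_contFractSet_iff.1 hx
  obtain ⟨w, hw⟩ := exists_word (n := n) ha
  refine Set.mem_iUnion.2 ⟨w, _, (tendsto_cfMap_zero (a := fun j => a (j + n))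
    fun j => ha (j + n)).1, ?_⟩
  rw [hw, ← cfValue_eq_cfMap ha n]

/-- The 4 is the square of the distortion constant 2. -/
theorem ediam_cfMap_image_le {m n : ℕ} (w : Fin n → Fin m) {x₀ : ℝ} (hx₀ : x₀ ∈ cfInterval m) :
    Metric.ediam (cfMap (wordDigits w) '' cfInterval m)
      ≤ ENNReal.ofReal (4 * cfDen (wordDigits w) x₀ ^ (-2 : ℝ)) := by
  have h1 := one_le_of_mem_wordDigits w
  have h0 := cfInterval_subset m hx₀
  refine Metric.ediam_le fun y hy z hz => ?_
  obtain ⟨y, hy, rfl⟩ := hy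
  obtain ⟨z, hz, rfl⟩ := hz
  have hy := cfInterval_subset m hy
  have hz := cfInterval_subset m hz
  rw [edist_dist, Real.dist_eq, abs_cfMap_sub h1 hy.1 hz.1]
  refine ENNReal.ofReal_le_ofReal ?_
  have d0 := cfDen_pos h1 h0.1
  have dy := cfDen_le_two_mul h1 h0 hy
  have dz := cfDen_le_two_mul h1 h0 hz
  have h4 : |y - z| ≤ 1 := by
    rw [abs_le]; constructor <;> linarith [hy.1, hy.2, hz.1, hz.2]
  rw [Real.rpow_neg d0.le, Real.rpow_two]
  have h5 : cfDen (wordDigits w) x₀ ^ 2 / 4 ≤ cfDen (wordDigits w) y * cfDen (wordDigits w) z := by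
    nlinarith
  calc |y - z| / (cfDen (wordDigits w) y * cfDen (wordDigits w) z)
      ≤ 1 / (cfDen (wordDigits w) x₀ ^ 2 / 4) := div_le_div₀ zero_le_one h4 (by positivity) h5
    _ = 4 * (cfDen (wordDigits w) x₀ ^ 2)⁻¹ := by field_simp

/-- With s = 2t, diam^t is comparable to the weight cfDen^(-s), so the supersolution f bounds the
cover sums at every level while the mesh tends to 0. -/
theorem dimH_contFractSet_le {m : ℕ} (hm : 1 ≤ m) {t : ℝ} (ht : 0 < t) {f : ℝ → ℝ} {c : ℝ}
    (hc : 0 < c) (hf : ∀ x ∈ cfInterval m, c ≤ f x)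
    (h : ∀ x ∈ cfInterval m, transferOp m (2 * t) f x ≤ f x) :
    dimH (contFractSet m) ≤ ENNReal.ofReal t := by
  set x₀ : ℝ := 1 / (m + 1)
  have hx₀ : x₀ ∈ cfInterval m := left_mem_cfInterval hm
  have key : ∀ n : ℕ, ∑ w : Fin n → Fin m,
      Metric.ediam (cfMap (wordDigits w) '' cfInterval m) ^ t
        ≤ ENNReal.ofReal (4 ^ t * (f x₀ / c)) := by
    intro n
    have h1 : ∀ w : Fin n → Fin m, Metric.ediam (cfMap (wordDigits w) '' cfInterval m) ^ t
        ≤ ENNReal.ofReal (4 ^ t * (cfDen (wordDigits w) x₀ ^ (-(2 * t)))) := by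
      intro w
      have d0 := cfDen_pos (one_le_of_mem_wordDigits w) (cfInterval_subset m hx₀).1
      refine (ENNReal.rpow_le_rpow (ediam_cfMap_image_le w hx₀) ht.le).trans ?_
      rw [ENNReal.ofReal_rpow_of_nonneg (by positivity) ht.le,
        Real.mul_rpow (by norm_num) (by positivity), ← Real.rpow_mul d0.le]
      rw [neg_mul]
    refine (Finset.sum_le_sum fun w _ => h1 w).trans ?_
    rw [← ENNReal.ofReal_sum_of_nonneg fun w _ => by
      have d0 := cfDen_pos (one_le_of_mem_wordDigits w) (cfInterval_subset m hx₀).1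
      positivity, ← Finset.mul_sum]
    refine ENNReal.ofReal_le_ofReal (mul_le_mul_of_nonneg_left ?_ (by positivity))
    rw [le_div_iff₀ hc, Finset.sum_mul]
    refine le_trans (Finset.sum_le_sum fun w _ => ?_) (wordSum_le h n hx₀)
    have d0 := cfDen_pos (one_le_of_mem_wordDigits w) (cfInterval_subset m hx₀).1
    exact mul_le_mul_of_nonneg_left (hf _ (cfMap_mem_cfInterval (mem_wordDigits w) hx₀))
      (by positivity)
  have hμ : μH[t] (contFractSet m) ≤ ENNReal.ofReal (4 ^ t * (f x₀ / c)) := by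
    refine (Measure.hausdorffMeasure_le_liminf_sum t (contFractSet m) (l := atTop)
      (fun n => ENNReal.ofReal (((1 + 1 / (m + 1) : ℝ)⁻¹) ^ n)) ?_
      (fun n (w : Fin n → Fin m) => cfMap (wordDigits w) '' cfInterval m)
      (Eventually.of_forall fun n w => ?_)
      (Eventually.of_forall fun n => contFractSet_subset_iUnion m n)).trans ?_
    · rw [← ENNReal.ofReal_zero]
      exact ENNReal.tendsto_ofReal (tendsto_ratio_pow m)
    · refine Metric.ediam_le fun y hy z hz => ?_
      obtain ⟨y, hy, rfl⟩ := hy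
      obtain ⟨z, hz, rfl⟩ := hz
      rw [edist_dist, Real.dist_eq]
      refine ENNReal.ofReal_le_ofReal ?_
      have := abs_cfMap_sub_le (mem_wordDigits w) hy hz
      rwa [length_wordDigits] at this
    · exact (liminf_le_liminf (Eventually.of_forall key)).trans (by simp)
  have : dimH (contFractSet m) ≤ (t.toNNReal : ℝ≥0∞) := by
    refine dimH_le_of_hausdorffMeasure_ne_top ?_
    rw [Real.coe_toNNReal t ht.le]
    exact ne_top_of_le_ne_top ENNReal.ofReal_ne_top hμ
  exact this

/-! ### Lower bound for the dimension -/

/-- Cut [0,1) into consecutive intervals of lengths p i; the digit names the interval, and σ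
rescales it to [0,1). -/
theorem exists_digit_expansion {ι : Type*} [Fintype ι] {p : ι → ℝ} (hp : ∀ i, 0 < p i)
    (hsum : ∑ i, p i = 1) :
    ∃ (c : ι → ℝ) (a : ℝ → ι) (σ : ℝ → ℝ), ∀ y ∈ Set.Ico (0 : ℝ) 1,
      σ y ∈ Set.Ico (0 : ℝ) 1 ∧ y = c (a y) + p (a y) * σ y := by
  classical
  have key : ∀ s : Finset ι, ∃ c : ι → ℝ, ∀ y ∈ Set.Ico (0 : ℝ) (∑ i ∈ s, p i),
      ∃ i ∈ s, ∃ y' ∈ Set.Ico (0 : ℝ) 1, y = c i + p i * y' := by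
    intro s
    induction s using Finset.induction_on with
    | empty => exact ⟨0, fun y hy => absurd (hy.1.trans_lt hy.2) (by simp)⟩
    | insert j s hj ih =>
      obtain ⟨c, hc⟩ := ih
      refine ⟨Function.update c j (∑ i ∈ s, p i), fun y hy => ?_⟩
      rcases lt_or_ge y (∑ i ∈ s, p i) with h | h
      · obtain ⟨i, hi, y', hy', e⟩ := hc y ⟨hy.1, h⟩
        refine ⟨i, Finset.mem_insert_of_mem hi, y', hy', ?_⟩
        rwa [Function.update_of_ne (ne_of_mem_of_not_mem hi hj)]
      · refine ⟨j, Finset.mem_insert_self _ _, (y - ∑ i ∈ s, p i) / p j, ⟨?_, ?_⟩, ?_⟩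
        · exact div_nonneg (by linarith) (hp j).le
        · have := hy.2
          rw [Finset.sum_insert hj] at this
          rw [div_lt_one (hp j)]; linarith
        · rw [Function.update_self, mul_div_cancel₀ _ (hp j).ne']; ring
  obtain ⟨c, hc⟩ := key Finset.univ
  rw [hsum] at hc
  have hne : Nonempty ι := ⟨(hc 0 (by simp)).choose⟩
  choose! a ha σ hσ using hc
  exact ⟨c, a, σ, fun y hy => hσ y hy⟩

/-- A parametrization `T` of a self-similar set by digit expansions of the points of `[0, 1)`
with weights `p i ≤ r i ^ t`, where the `i`-th branch contracts at most by `r i` and the branches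
are `g`-separated, has an image of dimension at least `t`. -/
theorem le_dimH_image_of_expansion {ι : Type*} {a : ℝ → ι} {σ T : ℝ → ℝ} {c p r : ι → ℝ}
    {t g κ : ℝ} (ht : 0 < t) (hg : 0 < g) (hκ0 : 0 ≤ κ) (hκ : κ < 1) (hp0 : ∀ i, 0 < p i)
    (hr0 : ∀ i, 0 ≤ r i)
    (hpκ : ∀ i, p i ≤ κ) (hpr : ∀ i, p i ≤ r i ^ t)
    (hσ : ∀ y ∈ Set.Ico (0 : ℝ) 1, σ y ∈ Set.Ico (0 : ℝ) 1 ∧ y = c (a y) + p (a y) * σ y)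
    (hsep : ∀ y ∈ Set.Ico (0 : ℝ) 1, ∀ z ∈ Set.Ico (0 : ℝ) 1, a y ≠ a z → g ≤ |T y - T z|)
    (hexp : ∀ y ∈ Set.Ico (0 : ℝ) 1, ∀ z ∈ Set.Ico (0 : ℝ) 1, a y = a z →
      r (a y) * |T (σ y) - T (σ z)| ≤ |T y - T z|) :
    ENNReal.ofReal t ≤ dimH (T '' Set.Ico (0 : ℝ) 1) := by
  -- Strip common digits: each one multiplies |y - z| by p ≤ r^t and the image distance by at least
  -- r. Once digits differ, separation gives a ratio of at least 1; κ^n covers pairs still agreeing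
  -- after n digits.
  have key : ∀ n : ℕ, ∀ y ∈ Set.Ico (0 : ℝ) 1, ∀ z ∈ Set.Ico (0 : ℝ) 1,
      |y - z| ≤ (|T y - T z| / g) ^ t + κ ^ n := by
    intro n
    induction n with
    | zero =>
      intro y hy z hz
      have : |y - z| ≤ 1 := by
        rw [abs_le]; constructor <;> linarith [hy.1, hy.2, hz.1, hz.2]
      have : 0 ≤ (|T y - T z| / g) ^ t := by positivity
      rw [pow_zero]; linarith
    | succ n ih =>
      intro y hy z hz
      by_cases h : a y = a z
      · obtain ⟨hy1, hy2⟩ := hσ y hy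
        obtain ⟨hz1, hz2⟩ := hσ z hz
        have e : |y - z| = p (a y) * |σ y - σ z| := by
          rw [← h] at hz2
          rw [show y - z = p (a y) * (σ y - σ z) by linear_combination hy2 - hz2, abs_mul,
            abs_of_pos (hp0 (a y))]
        rw [e]
        calc p (a y) * |σ y - σ z|
            ≤ p (a y) * ((|T (σ y) - T (σ z)| / g) ^ t + κ ^ n) :=
              mul_le_mul_of_nonneg_left (ih _ hy1 _ hz1) (hp0 _).le
          _ ≤ r (a y) ^ t * (|T (σ y) - T (σ z)| / g) ^ t + κ * κ ^ n := by
              rw [mul_add]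
              exact add_le_add (mul_le_mul_of_nonneg_right (hpr _) (by positivity))
                (mul_le_mul_of_nonneg_right (hpκ _) (by positivity))
          _ = (r (a y) * |T (σ y) - T (σ z)| / g) ^ t + κ ^ (n + 1) := by
              rw [← Real.mul_rpow (hr0 _) (by positivity), pow_succ', mul_div_assoc]
          _ ≤ (|T y - T z| / g) ^ t + κ ^ (n + 1) := by
              have h1 := hexp y hy z hz h
              have h2 : 0 ≤ r (a y) * |T (σ y) - T (σ z)| := mul_nonneg (hr0 _) (abs_nonneg _)
              gcongr
      · have h1 : 1 ≤ (|T y - T z| / g) ^ t :=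
          Real.one_le_rpow ((one_le_div hg).2 (hsep y hy z hz h)) ht.le
        have h2 : |y - z| ≤ 1 := by
          rw [abs_le]; constructor <;> linarith [hy.1, hy.2, hz.1, hz.2]
        have : 0 ≤ κ ^ (n + 1) := by positivity
        linarith
  have key' : ∀ y ∈ Set.Ico (0 : ℝ) 1, ∀ z ∈ Set.Ico (0 : ℝ) 1,
      |y - z| ≤ (|T y - T z| / g) ^ t := fun y hy z hz => by
    have h1 : Tendsto (fun n : ℕ => (|T y - T z| / g) ^ t + κ ^ n) atTop
        (𝓝 ((|T y - T z| / g) ^ t + 0)) :=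
      (tendsto_pow_atTop_nhds_zero_of_lt_one hκ0 hκ).const_add _
    rw [add_zero] at h1
    exact ge_of_tendsto' h1 fun n => key n y hy z hz
  have hinj : Set.InjOn T (Set.Ico (0 : ℝ) 1) := fun y hy z hz h => by
    have := key' y hy z hz
    rw [h, sub_self, abs_zero, zero_div, Real.zero_rpow ht.ne'] at this
    exact sub_eq_zero.1 (abs_nonpos_iff.1 this)
  have hleft := hinj.leftInvOn_invFunOn
  set S := Function.invFunOn T (Set.Ico (0 : ℝ) 1)
  have hold : HolderOnWith (Real.toNNReal ((1 / g) ^ t)) t.toNNReal S (T '' Set.Ico (0 : ℝ) 1) := by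
    rintro _ ⟨y, hy, rfl⟩ _ ⟨z, hz, rfl⟩
    rw [hleft hy, hleft hz, Real.coe_toNNReal t ht.le, edist_dist, edist_dist, Real.dist_eq,
      Real.dist_eq, ENNReal.ofReal_rpow_of_nonneg (abs_nonneg _) ht.le]
    change _ ≤ ENNReal.ofReal _ * _
    rw [← ENNReal.ofReal_mul (by positivity), ← Real.mul_rpow (by positivity) (abs_nonneg _),
      one_div_mul_eq_div]
    exact ENNReal.ofReal_le_ofReal (key' y hy z hz)
  -- The t-Hölder inverse maps the image onto [0,1), of dimension 1, so 1 ≤ dim / t.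
  have h1 := hold.dimH_image_le (Real.toNNReal_pos.2 ht)
  rw [hleft.image_image, Real.dimH_of_nonempty_interior (by rw [interior_Ico]; exact ⟨1 / 2, by norm_num⟩),
    Module.finrank_self, Nat.cast_one] at h1
  have h2 : (t.toNNReal : ℝ≥0∞) ≠ 0 := by simpa using ht
  rw [ENNReal.le_div_iff_mul_le (Or.inl h2) (Or.inl ENNReal.coe_ne_top), one_mul] at h1
  exact h1

/-- Distinct first digits differ by at least 1 while tails differ by at most (m+1)/(m+2), leaving a
gap 1/(m+2). Passing through a branch costs at most a factor (m+1)^2. -/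
theorem exists_cfMap_separation (m n : ℕ) :
    ∃ g : ℝ, 0 < g ∧ ∀ v w : List ℕ, v.length = n → w.length = n →
      (∀ a ∈ v, a ∈ Set.Icc 1 m) → (∀ a ∈ w, a ∈ Set.Icc 1 m) → v ≠ w →
      ∀ x ∈ cfInterval m, ∀ y ∈ cfInterval m, g ≤ |cfMap v x - cfMap w y| := by
  have hJ : ∀ x ∈ cfInterval m, ∀ y ∈ cfInterval m, |x - y| ≤ (m + 1) / (m + 2) := by
    intro x hx y hy
    have h0 := (cfInterval_subset m hx).1
    have h1 := (cfInterval_subset m hy).1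
    rw [abs_le]; constructor <;> linarith [hx.2, hy.2]
  have hbranch : ∀ {a b : ℕ} {x y : ℝ}, a ∈ Set.Icc 1 m → b ∈ Set.Icc 1 m → x ∈ cfInterval m →
      y ∈ cfInterval m → |(a + x) - (b + y)| / (m + 1) ^ 2 ≤ |1 / (a + x) - 1 / (b + y)| := by
    intro a b x y ha hb hx hy
    have hx := cfInterval_subset m hx
    have hy := cfInterval_subset m hy
    have a1 : (1 : ℝ) ≤ a := by exact_mod_cast ha.1
    have a2 : (a : ℝ) ≤ m := by exact_mod_cast ha.2
    have b1 : (1 : ℝ) ≤ b := by exact_mod_cast hb.1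
    have b2 : (b : ℝ) ≤ m := by exact_mod_cast hb.2
    have p1 : 0 < a + x := by linarith [hx.1]
    have p2 : 0 < b + y := by linarith [hy.1]
    have e : 1 / (a + x) - 1 / (b + y) = -((a + x) - (b + y)) / ((a + x) * (b + y)) := by
      field_simp; ring
    rw [e, abs_div, abs_neg, abs_of_pos (mul_pos p1 p2), sq]
    refine div_le_div_of_nonneg_left (abs_nonneg _) (by positivity) ?_
    exact mul_le_mul (by linarith [hx.2]) (by linarith [hy.2]) p2.le (by positivity)
  induction n with
  | zero =>
    refine ⟨1, one_pos, fun v w hv hw _ _ hne => absurd ?_ hne⟩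
    rw [List.length_eq_zero_iff.1 hv, List.length_eq_zero_iff.1 hw]
  | succ n ih =>
    obtain ⟨g, hg, h⟩ := ih
    refine ⟨min (1 / (m + 2) / (m + 1) ^ 2) (g / (m + 1) ^ 2), by positivity, ?_⟩
    intro v w hv hw hv' hw' hne x hx y hy
    obtain ⟨a, v, rfl⟩ := List.exists_cons_of_length_eq_add_one hv
    obtain ⟨b, w, rfl⟩ := List.exists_cons_of_length_eq_add_one hw
    have hv1 := fun k hk => hv' k (List.mem_cons_of_mem _ hk)
    have hw1 := fun k hk => hw' k (List.mem_cons_of_mem _ hk)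
    have hx' := cfMap_mem_cfInterval hv1 hx
    have hy' := cfMap_mem_cfInterval hw1 hy
    have hb := hbranch (hv' a List.mem_cons_self) (hw' b List.mem_cons_self) hx' hy'
    refine le_trans ?_ hb
    by_cases hab : a = b
    · subst hab
      refine (min_le_right _ _).trans ?_
      rw [add_sub_add_left_eq_sub]
      have := h v w (by simpa using hv) (by simpa using hw) hv1 hw1
        (fun e => hne (by rw [e])) x hx y hy
      gcongr
    · refine (min_le_left _ _).trans ?_
      have h1 : (1 : ℝ) ≤ |(a : ℝ) - b| := by
        have : (1 : ℤ) ≤ |(a : ℤ) - b| := Int.one_le_abs (sub_ne_zero.2 (by exact_mod_cast hab))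
        exact_mod_cast this
      have h2 := hJ _ hx' _ hy'
      have h3 : |(a : ℝ) - b| ≤ |(a + cfMap v x) - (b + cfMap w y)| + |cfMap v x - cfMap w y| := by
        have := abs_sub ((a + cfMap v x) - (b + cfMap w y)) (cfMap v x - cfMap w y)
        rwa [show (a + cfMap v x) - (b + cfMap w y) - (cfMap v x - cfMap w y) = (a : ℝ) - b by ring]
          at this
      have h4 : 1 / ((m : ℝ) + 2) = 1 - (m + 1) / (m + 2) := by field_simp; ring
      have h5 : 1 / ((m : ℝ) + 2) ≤ |(a + cfMap v x) - (b + cfMap w y)| := by linarith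
      gcongr

theorem le_dimH_contFractSet {m : ℕ} (hm : 1 ≤ m) {t : ℝ} (ht : 0 < t) {f : ℝ → ℝ}
    {c C lam : ℝ} (hc : 0 < c) (hf : ∀ x ∈ cfInterval m, c ≤ f x ∧ f x ≤ C) (hlam : 1 < lam)
    (h : ∀ x ∈ cfInterval m, lam * f x ≤ transferOp m (2 * t) f x) :
    ENNReal.ofReal t ≤ dimH (contFractSet m) := by
  set x₀ : ℝ := 1 / (m + 1)
  have hx₀ : x₀ ∈ cfInterval m := left_mem_cfInterval hm
  have hx₀' := cfInterval_subset m hx₀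
  have hC : 0 < C := hc.trans_le ((hf _ hx₀).1.trans (hf _ hx₀).2)
  -- The growth λ^n must absorb both the distortion loss 4^t and the oscillation C / c of f. Blocks
  -- must be nonempty for the division by n below.
  obtain ⟨n, hn, hn1⟩ := (((tendsto_pow_atTop_atTop_of_one_lt hlam).eventually_ge_atTop
    (4 ^ t * C / c)).and (eventually_ge_atTop 1)).exists
  have hd : ∀ w : Fin n → Fin m, 1 ≤ cfDen (wordDigits w) x₀ := fun w =>
    (one_le_pow₀ (by linarith [show (0 : ℝ) ≤ 1 / (m + 1) by positivity])).trans
      (pow_le_cfDen (mem_wordDigits w) hx₀)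
  -- A lower bound for the contraction on all of [0,1]: distortion bounds each denominator by twice
  -- its value at x₀.
  set r : (Fin n → Fin m) → ℝ := fun w => (4 * cfDen (wordDigits w) x₀ ^ (2 : ℝ))⁻¹ with hr
  have hr0 : ∀ w, 0 < r w := fun w => by have := hd w; positivity
  have hr4 : ∀ w, r w ≤ 1 / 4 := fun w => by
    rw [hr, one_div]
    exact inv_anti₀ (by norm_num) (by nlinarith [Real.one_le_rpow (hd w) (zero_le_two (α := ℝ))])
  have hrt : ∀ w, r w ^ t = (4 ^ t)⁻¹ * cfDen (wordDigits w) x₀ ^ (-(2 * t)) := fun w => by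
    have h0 : 0 ≤ cfDen (wordDigits w) x₀ := by linarith [hd w]
    simp only [hr]
    rw [Real.inv_rpow (by positivity), Real.mul_rpow (by norm_num) (by positivity),
      ← Real.rpow_mul h0, mul_inv, ← Real.rpow_neg h0]
  set Z := ∑ w, r w ^ t with hZ
  have hZ1 : 1 ≤ Z := by
    have h1 := le_wordSum (by linarith) h n hx₀
    have h2 : wordSum m n (2 * t) f x₀ ≤ C * (4 ^ t * Z) := by
      rw [hZ, Finset.mul_sum, Finset.mul_sum, wordSum]
      refine Finset.sum_le_sum fun w _ => ?_
      have h0 : 0 ≤ cfDen (wordDigits w) x₀ := by linarith [hd w]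
      rw [hrt, mul_inv_cancel_left₀ (by positivity), mul_comm]
      exact mul_le_mul_of_nonneg_right (hf _ (cfMap_mem_cfInterval (mem_wordDigits w) hx₀)).2
        (by positivity)
    have h3 : 4 ^ t * C ≤ lam ^ n * f x₀ := by
      rw [div_le_iff₀ hc] at hn
      exact hn.trans (mul_le_mul_of_nonneg_left (hf _ hx₀).1 (by positivity))
    have h4 : (4 ^ t * C) * 1 ≤ (4 ^ t * C) * Z := by linarith
    exact le_of_mul_le_mul_left h4 (by positivity)
  have hZ0 : 0 < Z := by linarith
  obtain ⟨k, a, σ, hσ⟩ := exists_digit_expansion (p := fun w => r w ^ t / Z)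
    (fun w => by have := hr0 w; positivity) (by rw [← Finset.sum_div, ← hZ, div_self hZ0.ne'])
  -- Concatenate the words a(y), a(σ y), …: position j is letter j % n of block j / n.
  set d : ℝ → ℕ → ℕ := fun y j => (a (σ^[j / n] y) ⟨j % n, Nat.mod_lt _ hn1⟩ : ℕ) + 1 with hd'
  have hdm : ∀ y j, d y j ∈ Set.Icc 1 m := fun y j =>
    ⟨Nat.le_add_left _ _, (a (σ^[j / n] y) ⟨j % n, Nat.mod_lt _ hn1⟩).2⟩
  have hpre : ∀ y, seqPrefix (d y) n = wordDigits (a y) := fun y => by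
    rw [seqPrefix, wordDigits]
    congr 1
    funext i
    simp only [hd', Nat.div_eq_of_lt i.2, Nat.mod_eq_of_lt i.2, Function.iterate_zero, id]
  have hshift : ∀ y, (fun j => d y (j + n)) = d (σ y) := fun y => by
    funext j
    simp only [hd', Nat.add_mod_right, Nat.add_div_right j hn1, Function.iterate_succ_apply]
  set T : ℝ → ℝ := fun y => cfValue (d y) with hT
  have hTJ : ∀ y, T y ∈ cfInterval m := fun y => (tendsto_cfMap_zero (hdm y)).1
  have hTeq : ∀ y, T y = cfMap (wordDigits (a y)) (T (σ y)) := fun y => by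
    rw [hT]
    simp only
    rw [cfValue_eq_cfMap (hdm y) n, hpre, hshift]
  obtain ⟨g, hg, hsep⟩ := exists_cfMap_separation m n
  have hdim : ENNReal.ofReal t ≤ dimH (T '' Set.Ico (0 : ℝ) 1) := by
    refine le_dimH_image_of_expansion (r := r) (κ := (1 / 4) ^ t) ht hg (by positivity)
      (Real.rpow_lt_one (by norm_num) (by norm_num) ht)
      (fun w => by have := hr0 w; positivity) (fun w => (hr0 w).le) (fun w => ?_)
      (fun w => div_le_self (by have := hr0 w; positivity) hZ1) hσ ?_ ?_
    · exact (div_le_self (by have := hr0 w; positivity) hZ1).trans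
        (Real.rpow_le_rpow (hr0 w).le (hr4 w) ht.le)
    · intro y _ z _ hne
      rw [hTeq y, hTeq z]
      exact hsep _ _ (length_wordDigits _) (length_wordDigits _) (mem_wordDigits _)
        (mem_wordDigits _) (fun e => hne (wordDigits_injective e)) _ (hTJ _) _ (hTJ _)
    · intro y _ z _ he
      rw [hTeq y, hTeq z, ← he]
      have h1 := one_le_of_mem_wordDigits (a y)
      have hy := cfInterval_subset m (hTJ (σ y))
      have hz := cfInterval_subset m (hTJ (σ z))
      rw [abs_cfMap_sub h1 hy.1 hz.1, div_eq_inv_mul]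
      refine mul_le_mul_of_nonneg_right (inv_anti₀
        (mul_pos (cfDen_pos h1 hy.1) (cfDen_pos h1 hz.1)) ?_) (abs_nonneg _)
      have dy := cfDen_le_two_mul h1 hy hx₀'
      have dz := cfDen_le_two_mul h1 hz hx₀'
      have pz := cfDen_pos h1 hz.1
      rw [Real.rpow_two]
      nlinarith [hd (a y)]
  refine hdim.trans (dimH_mono ?_)
  rintro _ ⟨y, -, rfl⟩
  exact mem_contFractSet_iff.2 ⟨d y, hdm y, rfl⟩

/-! ### The digits `{1, …, 5}` -/

/-- The approximate eigenfunction with coefficients `eigenCoeffs`, scaled by `10 ^ 20`. -/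
noncomputable def eigenApprox (x : ℝ) : ℝ := evalList eigenCoeffs (2 * x - 1)

theorem abs_two_mul_sub_one_le {x : ℝ} (hx : x ∈ Set.Icc (0 : ℝ) 1) : |2 * x - 1| ≤ 1 :=
  abs_le.2 ⟨by linarith [hx.1], by linarith [hx.2]⟩

theorem eigenApprox_bounds {x : ℝ} (hx : x ∈ Set.Icc (0 : ℝ) 1) :
    lowerList eigenCoeffs ≤ eigenApprox x ∧ eigenApprox x ≤ normList eigenCoeffs :=
  ⟨lowerList_le _ (abs_two_mul_sub_one_le hx),
    (abs_le.1 (abs_evalList_le _ (abs_two_mul_sub_one_le hx))).2⟩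

theorem abs_transferOp_eigenApprox_sub_le {p q : ℤ} (hq : 0 < q) (hpq : q ≤ p) (hpq' : p ≤ 2 * q)
    {us : List ℤ} (hus : us.length = 5) {x : ℝ} (hx : x ∈ Set.Icc (0 : ℝ) 1) :
    |transferOp 5 (p / q) eigenApprox x
        - evalList (transferList (10 ^ 20) p q eigenCoeffs 1 (10 ^ 20) 0 us).1 (2 * x - 1)|
      ≤ (transferList (10 ^ 20) p q eigenCoeffs 1 (10 ^ 20) 0 us).2 := by
  have h := abs_transferList_le (S := 10 ^ 20) (by norm_num) hq hpq hpq' eigenCoeffs_bounds.1 hx us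
    1 le_rfl (10 ^ 20) 0 (by simp)
  rw [hus, Finset.sum_range, Nat.cast_one (R := ℤ)] at h
  convert h using 4
  refine Finset.sum_congr rfl fun i _ => ?_
  simp only [eigenApprox]
  push_cast
  rw [add_comm (1 : ℝ) (i : ℕ)]

theorem lower_transferOp_eigenApprox {x : ℝ} (hx : x ∈ Set.Icc (0 : ℝ) 1) :
    eigenApprox x + 1 ≤ transferOp 5 (5230184023 / 3125000000) eigenApprox x := by
  have h1 := abs_transferOp_eigenApprox_sub_le (p := 5230184023) (q := 3125000000) (by norm_num)
    (by norm_num) (by norm_num) (us := powInitLower) rfl hx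
  have h2 := transferList_lower
  simp only at h2
  set T := transferList (10 ^ 20) 5230184023 3125000000 eigenCoeffs 1 (10 ^ 20) 0 powInitLower
  have h3 := lowerList_le (addList T.1 (eigenCoeffs.map (-1 * ·))) (abs_two_mul_sub_one_le hx)
  rw [evalList_addList, evalList_map_mul] at h3
  -- A strict inequality of integers leaves a slack of 1.
  have h4 : (T.2 : ℝ) + 1 ≤ lowerList (addList T.1 (eigenCoeffs.map (-1 * ·))) := by exact_mod_cast h2
  push_cast at h1 h3
  rw [eigenApprox]
  linarith [(abs_le.1 h1).1]

theorem transferOp_eigenApprox_le {x : ℝ} (hx : x ∈ Set.Icc (0 : ℝ) 1) :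
    transferOp 5 (418414721841 / 250000000000) eigenApprox x ≤ eigenApprox x := by
  have h1 := abs_transferOp_eigenApprox_sub_le (p := 418414721841) (q := 250000000000) (by norm_num)
    (by norm_num) (by norm_num) (us := powInitUpper) rfl hx
  have h2 := transferList_upper
  simp only at h2
  set T := transferList (10 ^ 20) 418414721841 250000000000 eigenCoeffs 1 (10 ^ 20) 0 powInitUpper
  have h3 := lowerList_le (addList eigenCoeffs (T.1.map (-1 * ·))) (abs_two_mul_sub_one_le hx)
  rw [evalList_addList, evalList_map_mul] at h3
  have h4 : (T.2 : ℝ) ≤ lowerList (addList eigenCoeffs (T.1.map (-1 * ·))) := by exact_mod_cast h2.le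
  push_cast at h1 h3
  rw [eigenApprox]
  linarith [(abs_le.1 h1).2]

theorem mainTheorem6 :
    dimH (contFractSet 5) ∈
      Set.Icc (ENNReal.ofReal (0.836829443681 - 10 ^ (-12 : ℤ)))
        (ENNReal.ofReal (0.836829443681 + 10 ^ (-12 : ℤ))) ∧
    (5 / 6 : ℝ≥0∞) < dimH (contFractSet 5) := by
  have hsub := cfInterval_subset 5
  have hpos : (0 : ℝ) < lowerList eigenCoeffs := by exact_mod_cast eigenCoeffs_bounds.2
  have hC : (0 : ℝ) < normList eigenCoeffs :=
    hpos.trans_le ((eigenApprox_bounds (x := 0) (by simp)).1.trans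
      (eigenApprox_bounds (x := 0) (by simp)).2)
  have hlow : ENNReal.ofReal (0.836829443681 - 10 ^ (-12 : ℤ)) ≤ dimH (contFractSet 5) := by
    refine le_dimH_contFractSet (by norm_num) (by norm_num) hpos
      (fun x hx => eigenApprox_bounds (hsub hx))
      -- The additive slack 1 becomes multiplicative because f ≤ `normList eigenCoeffs`.
      (lam := 1 + 1 / normList eigenCoeffs) (by linarith [one_div_pos.2 hC]) fun x hx => ?_
    have e : (2 * (0.836829443681 - 10 ^ (-12 : ℤ)) : ℝ) = 5230184023 / 3125000000 := by norm_num
    rw [e]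
    refine le_trans ?_ (lower_transferOp_eigenApprox (hsub hx))
    have : 1 / normList eigenCoeffs * eigenApprox x ≤ 1 := by
      rw [one_div_mul_eq_div, div_le_one hC]
      exact (eigenApprox_bounds (hsub hx)).2
    linarith
  refine ⟨⟨hlow, ?_⟩, lt_of_lt_of_le ?_ hlow⟩
  · refine dimH_contFractSet_le (by norm_num) (by norm_num) hpos
      (fun x hx => (eigenApprox_bounds (hsub hx)).1) fun x hx => ?_
    have e : (2 * (0.836829443681 + 10 ^ (-12 : ℤ)) : ℝ) = 418414721841 / 250000000000 := by
      norm_num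
    rw [e]
    exact transferOp_eigenApprox_le (hsub hx)
  · have e : (5 / 6 : ℝ≥0∞) = ENNReal.ofReal (5 / 6) := by
      rw [ENNReal.ofReal_div_of_pos (by norm_num)]; norm_num
    rw [e]
    exact (ENNReal.ofReal_lt_ofReal_iff (by norm_num)).2 (by norm_num)
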